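/- Let $d=(d_{ij})_{i\neq j}$, $i,j\in\{1,2,3,4\}$, be real numbers (of any sign) such that (a) there are affinely independent points $v_1,v_2,v_3,v_4\in\mathbb{R}^3$ with $|v_i-v_j|=\ell_{ij}:=d_{ij}+d_{ji}$ for all $i\ne j$, and (b) $d_{ij}^2+d_{jk}^2+d_{ki}^2=d_{ji}^2+d_{ik}^2+d_{kj}^2$ for all distinct $i,j,k$. Such a $d$ is called a metric on the tetrahedron $\{1,2,3,4\}$. Fix such points $v_1,\dots,v_4$. Centers. Let $c_{ij}=v_i+\frac{d_{ij}}{\ell_{ij}}(v_j-v_i)$. Let $c_{ijk}$ be the unique point of the plane $v_iv_jv_k$ with $(c_{ijk}-c_{ab})\perp(v_b-v_a)$ for all distinct $a,b\in\{i,j,k\}$, and let $c_{1234}$ be the unique point of $\mathbb{R}^3$ with $(c_{1234}-c_{ab})\perp(v_b-v_a)$ for all distinct $a,b\in\{1,2,3,4\}$. (These points exist because of (b).) Signed heights and dual areas. For distinct $i,j,k,l$, let $h_{ij,k}$ be the distance between $c_{ijk}$ and $c_{ij}$, taken with sign $+$ if $c_{ijk}$ lies strictly on the same side of the line $v_iv_j$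 as $v_k$ within the plane $v_iv_jv_k$, and with sign $-$ otherwise. Let $h_{ijk,l}$ be the distance between $c_{1234}$ and $c_{ijk}$, taken with sign $+$ if $c_{1234}$ lies strictly on the same side of the plane $v_iv_jv_k$ as $v_l$, and with sign $-$ otherwise. Let $$A_{ij,kl}=\tfrac12\left(h_{ij,k}h_{ijk,l}+h_{ij,l}h_{ijl,k}\right)$$ be the signed area of the planar quadrilateral $c_{1234}c_{ijk}c_{ij}c_{ijl}$. Dihedral angles. For edge lengths of a nondegenerate Euclidean tetrahedron, let $\beta_{ij}=\beta_{ij,kl}$ ($\{i,j,k,l\}=\{1,2,3,4\}$) be the dihedral angle at the edge $\{i,j\}$, regarded as a function of the six edge lengths. Theorem. Each $\beta_{ij}$ is differentiable at $\ell=(\ell_{ij})$. For $\delta f_4\in\mathbb{R}$, let $\delta\ell$ be the variation of the edge lengths given by $$\delta\ell_{12}=\delta\ell_{13}=\delta\ell_{23}=0,\qquad \delta\ell_{i4}=d_{4i}\,\delta f_4\quad(i=1,2,3),$$ and let $\delta\beta_{ij}$ be the differential of $\beta_{ij}$ at $\ell$ applied to $\delta\ell$. Then $$d_{14}\delta\beta_{14}+d_{12}\delta\beta_{12}+d_{13}\delta\beta_{13}=2\frac{A_{14,23}}{\ell_{14}}\delta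 f_4,$$ $$d_{24}\delta\beta_{24}+d_{23}\delta\beta_{23}+d_{21}\delta\beta_{12}=2\frac{A_{24,13}}{\ell_{24}}\delta f_4,$$ $$d_{34}\delta\beta_{34}+d_{32}\delta\beta_{23}+d_{31}\delta\beta_{13}=2\frac{A_{34,12}}{\ell_{34}}\delta f_4,$$ $$d_{41}\delta\beta_{14}+d_{42}\delta\beta_{24}+d_{43}\delta\beta_{34}=\left[-2\frac{A_{14,23}}{\ell_{14}}-2\frac{A_{24,13}}{\ell_{24}}-2\frac{A_{34,12}}{\ell_{34}}\right]\delta f_4.$$ -/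

import Mathlib

noncomputable section

/-- Euclidean three-space. -/
abbrev E3 : Type := EuclideanSpace ℝ (Fin 3)

/-- The six edges of the tetrahedron. The vertices labelled `1, 2, 3, 4` in the usual
notation are the elements `0, 1, 2, 3` of `Fin 4`. -/
abbrev Edge : Type := {e : Sym2 (Fin 4) // ¬ e.IsDiag}

/-- The edge `{i, j}`. -/
def edge (i j : Fin 4) (h : i ≠ j := by decide) : Edge :=
  ⟨s(i, j), by simpa using h⟩

/-- `v` embeds the tetrahedron in Euclidean space as a nondegenerate simplex with edge
lengths `ℓ`. -/
structure IsRealization (ℓ : Edge → ℝ) (v : Fin 4 → E3) : Prop where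
  affineIndependent : AffineIndependent ℝ v
  dist_eq : ∀ (i j : Fin 4) (h : i ≠ j), dist (v i) (v j) = ℓ (edge i j h)

/-- The edge lengths `ℓ_ij = d_ij + d_ji` induced by a function `d` on directed edges. (The
diagonal values `d i i` are never used.) -/
def edgeLength (d : Fin 4 → Fin 4 → ℝ) : Edge → ℝ :=
  fun e => Sym2.lift ⟨fun i j => d i j + d j i, fun _ _ => add_comm _ _⟩ e.1

/-- `d` is a piecewise flat metric on the tetrahedron: the induced edge lengths are those of a
nondegenerate Euclidean tetrahedron, and the compatibility condition holds on each face. -/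
structure IsMetric (d : Fin 4 → Fin 4 → ℝ) : Prop where
  exists_realization : ∃ v, IsRealization (edgeLength d) v
  compat : ∀ i j k : Fin 4, i ≠ j → j ≠ k → k ≠ i →
    d i j ^ 2 + d j k ^ 2 + d k i ^ 2 = d j i ^ 2 + d i k ^ 2 + d k j ^ 2

/-! ### Dihedral angles -/

/-- The dihedral angle at the edge `v i, v j` between the faces `i j k` and `i j l`: the angle
between the components of `v k - v i` and `v l - v i` orthogonal to the edge. -/
def dihedralAngle (v : Fin 4 → E3) (i j k l : Fin 4) : ℝ :=
  InnerProductGeometry.angle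
    ((Submodule.span ℝ {v j - v i})ᗮ.starProjection (v k - v i))
    ((Submodule.span ℝ {v j - v i})ᗮ.starProjection (v l - v i))

open Classical in
/-- The dihedral angle `β_{ij,kl}` as a function of the six edge lengths (with the value `0` when
no nondegenerate tetrahedron has these edge lengths). -/
def dihedral (i j k l : Fin 4) (ℓ : Edge → ℝ) : ℝ :=
  if h : ∃ v, IsRealization ℓ v then dihedralAngle h.choose i j k l else 0

/-! ### Centers and duals -/

/-- The center `c_ij` of an edge: the point of the line through `v i` and `v j` at signed distance
`d_ij` from `v i` (towards `v j`) and `d_ji` from `v j` (towards `v i`). -/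
def edgeCenter (v : Fin 4 → E3) (d : Fin 4 → Fin 4 → ℝ) (i j : Fin 4) : E3 :=
  AffineMap.lineMap (v i) (v j) (d i j / (d i j + d j i))

/-- `p` is the center of the face spanned by the vertices in `s`: it lies in the affine span of
this face, and the line or plane through each edge center orthogonal to that edge contains `p`. -/
structure IsCenter (v : Fin 4 → E3) (d : Fin 4 → Fin 4 → ℝ) (s : Finset (Fin 4)) (p : E3) :
    Prop where
  mem_span : p ∈ affineSpan ℝ (v '' s)
  orthogonal : ∀ i ∈ s, ∀ j ∈ s, i ≠ j → inner ℝ (p - edgeCenter v d i j) (v j - v i) = 0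

/-- The center of the face with vertex set `s`. -/
def center (v : Fin 4 → E3) (d : Fin 4 → Fin 4 → ℝ) (s : Finset (Fin 4)) : E3 :=
  Classical.epsilon (IsCenter v d s)

open Classical in
/-- `h_{ij,k}`: the distance between `c_ijk` and `c_ij`, with positive sign if `c_ijk` lies on the
same side of the line `v i v j` as `v k`, and negative sign otherwise. -/
def hEdge (v : Fin 4 → E3) (d : Fin 4 → Fin 4 → ℝ) (i j k : Fin 4) : ℝ :=
  if (affineSpan ℝ {v i, v j}).SSameSide (center v d {i, j, k}) (v k)
  then dist (center v d {i, j, k}) (edgeCenter v d i j)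
  else -dist (center v d {i, j, k}) (edgeCenter v d i j)

open Classical in
/-- `h_{ijk,l}`: the distance between `c_1234` and `c_ijk`, with positive sign if `c_1234` lies on
the same side of the plane `v i v j v k` as `v l`, and negative sign otherwise. -/
def hFace (v : Fin 4 → E3) (d : Fin 4 → Fin 4 → ℝ) (i j k l : Fin 4) : ℝ :=
  if (affineSpan ℝ {v i, v j, v k}).SSameSide (center v d Finset.univ) (v l)
  then dist (center v d Finset.univ) (center v d {i, j, k})
  else -dist (center v d Finset.univ) (center v d {i, j, k})

/-- `A_{ij,kl}`: the signed area of the planar quadrilateral `c_1234 c_ijk c_ij c_ijl`, the sum of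
the signed areas of its right triangles with legs `h_{ij,k}, h_{ijk,l}` and
`h_{ij,l}, h_{ijl,k}`. -/
def dualArea (v : Fin 4 → E3) (d : Fin 4 → Fin 4 → ℝ) (i j k l : Fin 4) : ℝ :=
  (hEdge v d i j k * hFace v d i j k l + hEdge v d i j l * hFace v d i j l k) / 2

/-! ### The definitions by choice do not depend on choices -/

theorem starProjection_orthogonal_span (u x : E3) :
    (Submodule.span ℝ {u})ᗮ.starProjection x = x - (inner ℝ u x / inner ℝ u u) • u := by
  rw [Submodule.starProjection_orthogonal_val, Submodule.starProjection_singleton,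
    real_inner_self_eq_norm_sq]
  simp

theorem angle_orthogonal (u x y : E3) :
    InnerProductGeometry.angle ((Submodule.span ℝ {u})ᗮ.starProjection x)
        ((Submodule.span ℝ {u})ᗮ.starProjection y) =
      Real.arccos ((inner ℝ x y - inner ℝ u x * inner ℝ u y / inner ℝ u u) /
        (√(inner ℝ x x - inner ℝ u x * inner ℝ u x / inner ℝ u u) *
          √(inner ℝ y y - inner ℝ u y * inner ℝ u y / inner ℝ u u))) := by
  have key : ∀ a b : E3, inner ℝ (a - (inner ℝ u a / inner ℝ u u) • u)
      (b - (inner ℝ u b / inner ℝ u u) • u) =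
      inner ℝ a b - inner ℝ u a * inner ℝ u b / inner ℝ u u := by
    intro a b
    simp only [inner_sub_left, inner_sub_right, real_inner_smul_left, real_inner_smul_right]
    rw [real_inner_comm u a]
    by_cases hu : inner ℝ u u = 0
    · rw [hu]
      simp
    · field_simp
      ring
  unfold InnerProductGeometry.angle
  simp only [starProjection_orthogonal_span, norm_eq_sqrt_real_inner, key]

/-- The dihedral angle of any realization of `ℓ` is the value of the function `dihedral`. -/
theorem dihedral_eq {ℓ : Edge → ℝ} {v : Fin 4 → E3} (hv : IsRealization ℓ v)
    (i j k l : Fin 4) : dihedral i j k l ℓ = dihedralAngle v i j k l := by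
  have h : ∃ v, IsRealization ℓ v := ⟨v, hv⟩
  have hw := h.choose_spec
  set w := h.choose with hwdef
  have hdist : ∀ a b, dist (w a) (w b) = dist (v a) (v b) := by
    intro a b
    by_cases hab : a = b
    · simp [hab]
    · rw [hw.dist_eq a b hab, hv.dist_eq a b hab]
  have hin : ∀ a b c : Fin 4, inner ℝ (w a - w c) (w b - w c) =
      inner ℝ (v a - v c) (v b - v c) := by
    intro a b c
    rw [real_inner_eq_norm_mul_self_add_norm_mul_self_sub_norm_sub_mul_self_div_two,
      real_inner_eq_norm_mul_self_add_norm_mul_self_sub_norm_sub_mul_self_div_two]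
    simp only [sub_sub_sub_cancel_right, ← dist_eq_norm, hdist]
  rw [dihedral, dif_pos h, ← hwdef]
  simp only [dihedralAngle, angle_orthogonal, hin]

theorem edgeLength_edge (d : Fin 4 → Fin 4 → ℝ) (i j : Fin 4) (h : i ≠ j) :
    edgeLength d (edge i j h) = d i j + d j i := rfl

/-- Every nonempty face has exactly one center. -/
theorem existsUnique_center {d : Fin 4 → Fin 4 → ℝ} (hd : IsMetric d) {v : Fin 4 → E3}
    (hv : IsRealization (edgeLength d) v) (s : Finset (Fin 4)) (hs : s.Nonempty) :
    ∃! p, IsCenter v d s p := by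
  obtain ⟨a, ha⟩ := hs
  have hdist : ∀ i j, i ≠ j → dist (v i) (v j) = d i j + d j i := fun i j h => by
    rw [hv.dist_eq i j h, edgeLength_edge]
  have hpos : ∀ i j, i ≠ j → 0 < d i j + d j i := fun i j h => by
    rw [← hdist i j h]
    exact dist_pos.2 (fun e => h (hv.affineIndependent.injective e))
  have hee : ∀ i j, i ≠ j → inner ℝ (edgeCenter v d i j - v i) (v j - v i) =
      d i j * (d i j + d j i) := fun i j h => by
    have h1 : edgeCenter v d i j - v i = (d i j / (d i j + d j i)) • (v j - v i) := by
      simp [edgeCenter, AffineMap.lineMap_apply]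
    rw [h1, real_inner_smul_left, real_inner_self_eq_norm_sq, ← dist_eq_norm, dist_comm,
      hdist i j h]
    have := (hpos i j h).ne'
    field_simp
  -- the center equations, relative to the base vertex `a`
  have hsub : ∀ p i j : E3, inner ℝ (p - i) (j - i) = inner ℝ p j - inner ℝ p i
      - (inner ℝ i j - inner ℝ i i) := fun p i j => by
    simp only [inner_sub_left, inner_sub_right]
    ring
  have hsq : ∀ i j, i ≠ j → inner ℝ (v i) (v i) - 2 * inner ℝ (v i) (v j)
      + inner ℝ (v j) (v j) = (d i j + d j i) ^ 2 := fun i j h => by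
    rw [← hdist i j h, dist_eq_norm, ← real_inner_self_eq_norm_sq]
    simp only [inner_sub_left, inner_sub_right, real_inner_comm (v i) (v j)]
    ring
  have horth : ∀ p i j, i ≠ j → (inner ℝ (p - edgeCenter v d i j) (v j - v i) = 0 ↔
      inner ℝ (p - v i) (v j - v i) = d i j * (d i j + d j i)) := fun p i j h => by
    rw [← hee i j h, ← sub_eq_zero (a := inner ℝ (p - v i) _), ← inner_sub_left,
      sub_sub_sub_cancel_right]
  obtain ⟨f, hf⟩ : ∃ f : E3 →ₗ[ℝ] ℝ, ∀ j, j ≠ a → f (v j - v a) = d a j * (d a j + d j a) := by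
    have hli := (affineIndependent_iff_linearIndependent_vsub ℝ v a).1 hv.affineIndependent
    obtain ⟨f, hf⟩ := LinearMap.exists_extend
      ((Module.Basis.span hli).constr ℝ fun j => d a j * (d a j + d j a))
    refine ⟨f, fun j hj => ?_⟩
    have h1 := (Module.Basis.span hli).constr_basis ℝ
      (fun j => d a j * (d a j + d j a)) ⟨j, hj⟩
    rw [← hf] at h1
    simpa [Module.Basis.span_apply] using h1
  set W := vectorSpan ℝ (v '' (s : Set (Fin 4))) with hW
  set b : E3 := (InnerProductSpace.toDual ℝ E3).symm (LinearMap.toContinuousLinearMap f) with hb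
  have hbf : ∀ x, inner ℝ b x = f x := fun x => by simp [hb]
  have hmemW : ∀ i ∈ s, ∀ j ∈ s, v j - v i ∈ W := fun i hi j hj =>
    vsub_mem_vectorSpan ℝ (Set.mem_image_of_mem v hj) (Set.mem_image_of_mem v hi)
  have hbase : ∀ p : E3, (∀ j ∈ s, j ≠ a →
      inner ℝ (p - v a) (v j - v a) = d a j * (d a j + d j a)) →
      ∀ i ∈ s, ∀ j ∈ s, i ≠ j → inner ℝ (p - v i) (v j - v i) = d i j * (d i j + d j i) := by
    intro p hp i hi j hj hij
    by_cases hia : i = a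
    · subst hia
      exact hp j hj (Ne.symm hij)
    have hI := hp i hi hia
    have e1 := hsq i a hia
    rw [hsub] at hI ⊢
    by_cases hja : j = a
    · subst hja
      rw [real_inner_comm (v i) (v j)] at hI
      linarith [real_inner_comm p (v j)]
    have hJ := hp j hj hja
    rw [hsub] at hJ
    have e2 := hsq j a hja
    have e3 := hsq i j hij
    have e4 := hd.compat i j a hij hja (Ne.symm hia)
    rw [real_inner_comm (v i) (v a)] at hI
    rw [real_inner_comm (v j) (v a)] at hJ
    linarith
  refine ⟨W.starProjection b + v a, ⟨?_, ?_⟩, ?_⟩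
  · exact vadd_mem_affineSpan_of_mem_affineSpan_of_mem_vectorSpan
      (subset_affineSpan ℝ _ (Set.mem_image_of_mem v ha)) (W.starProjection_apply_mem b)
  · intro i hi j hj hij
    rw [horth _ i j hij]
    refine hbase _ ?_ i hi j hj hij
    intro j hj hja
    rw [add_sub_cancel_right, Submodule.inner_starProjection_left_eq_right,
      Submodule.starProjection_eq_self_iff.2 (hmemW a ha j hj), hbf, hf j hja]
  · intro q hq
    have hqW : q - v a ∈ W := by
      have := AffineSubspace.vsub_mem_direction hq.mem_span
        (subset_affineSpan ℝ _ (Set.mem_image_of_mem v ha))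
      rwa [direction_affineSpan] at this
    have hzW : (q - v a) - W.starProjection b ∈ W := W.sub_mem hqW (W.starProjection_apply_mem b)
    have hz : ∀ x ∈ W, inner ℝ ((q - v a) - W.starProjection b) x = 0 := by
      intro x hx
      rw [hW, vectorSpan_eq_span_vsub_set_right ℝ (Set.mem_image_of_mem v ha)] at hx
      induction hx using Submodule.span_induction with
      | mem x hx =>
        obtain ⟨_, ⟨j, hj, rfl⟩, rfl⟩ := hx
        by_cases hja : j = a
        · simp [hja]
        · have h1 := (horth q a j (Ne.symm hja)).1 (hq.orthogonal a ha j hj (Ne.symm hja))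
          change inner ℝ (q - v a - W.starProjection b) (v j - v a) = 0
          rw [inner_sub_left, h1, Submodule.inner_starProjection_left_eq_right,
            Submodule.starProjection_eq_self_iff.2 (hmemW a ha j hj), hbf, hf j hja, sub_self]
      | zero => simp
      | add x y _ _ hx hy => rw [inner_add_right, hx, hy, add_zero]
      | smul c x _ hx => rw [real_inner_smul_right, hx, mul_zero]
    have h0 := inner_self_eq_zero.1 (hz _ hzW)
    rw [← sub_eq_zero.1 h0]
    simp

end

noncomputable section

/-! ### Gram entries and the dihedral angle -/

/-! Write `c` for the center of the whole tetrahedron. The center conditions say `⟪c - v i, v j - v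
i⟫ = d i j * ℓ_ij` for all `i ≠ j`. Hence the prescribed variation of the lengths is, to first
order, the one obtained by moving the fourth vertex `v 3` with velocity `δf • (v 3 - c)` and keeping
the other three fixed. The compatibility condition on the faces is what makes this consistent with
the Gram entries seen from any vertex.

Fix a vertex `i` and work with the Gram matrix of the three edge vectors leaving it. Both sides of
the theorem have the same irrational factor. By `IsRealization.fderiv_dihedral`, the derivative of
the angle at the edge `i j` is `ℓ_ij` times a rational expression `angleRate`, divided by the square
root of the Gram determinant. The weight `d i j` absorbs `ℓ_ij` into the inner product `d i j *
ℓ_ij`. By `two_mul_dualArea_div`, twice the dual area over the edge length is a sum of two rational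
terms `gramSchmidtProd` divided by the same root: each signed height is the component of `c - v i`
along a Gram-Schmidt vector.

What remains are two rational identities, `sum_mul_angleRate_base` for a fixed vertex and
`sum_mul_angleRate_apex` for the moving one. Given the first three equations, the fourth amounts to
the Schläfli formula `∑ ℓ_ij δβ_ij = 0`, but it is obtained here from its own identity.

Differentiability also needs the set of nondegenerate edge lengths to be open
(`IsRealization.eventually_exists`), because `dihedral` has a default value outside it. -/

/-- The inner product of the components of `y` and `z` orthogonal to `x`, in terms of
`X = ⟪x, x⟫`, `P = ⟪y, z⟫`, `Q = ⟪x, y⟫` and `R = ⟪x, z⟫`. -/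
def orthInner (X P Q R : ℝ) : ℝ := P - Q * R / X

/-- The Gram determinant of `x, y, z` in terms of `X = ⟪x, x⟫`, `Y = ⟪y, y⟫`, `Z = ⟪z, z⟫`,
`P = ⟪y, z⟫`, `Q = ⟪x, y⟫` and `R = ⟪x, z⟫`. -/
def gramDet (X Y Z P Q R : ℝ) : ℝ :=
  X * Y * Z + 2 * P * Q * R - X * P ^ 2 - Y * R ^ 2 - Z * Q ^ 2

/-- The rational factor in the derivative of the angle between the components of `y` and `z`
orthogonal to `x`; the primed variables are the derivatives of the Gram entries. -/
def angleRate (X Y Z P Q R X' Y' Z' P' Q' R' : ℝ) : ℝ :=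
  (P - Q * R / X) * (Y' - (Q' * Q + Q * Q') / X + Q * Q * X' / X ^ 2) / (2 * (Y - Q * Q / X)) +
    (P - Q * R / X) * (Z' - (R' * R + R * R') / X + R * R * X' / X ^ 2) / (2 * (Z - R * R / X)) -
    (P' - (Q' * R + Q * R') / X + Q * R * X' / X ^ 2)

/-- The product of `⟪p, y'⟫` and `⟪p, z'⟫`, where `x, y', z'` is the Gram-Schmidt
orthogonalization of `x, y, z` and `px = ⟪p, x⟫`, `py = ⟪p, y⟫`, `pz = ⟪p, z⟫`. -/
def gramSchmidtProd (X Y P Q R px py pz : ℝ) : ℝ :=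
  (py - Q / X * px) *
    (pz - R / X * px - orthInner X P Q R / orthInner X Y Q Q * (py - Q / X * px))

/-! ### The two rational identities. -/

/-- The vectors `a, b, e` are the edges leaving a fixed vertex, `e` ending at the moving one, and
`p` points to the center of the tetrahedron. The derivatives inserted are those of the Gram entries
when `a' = b' = 0` and `e' = t • (e - p)`. Only the area dual to `e` appears on the right. -/
theorem sum_mul_angleRate_base (aa bb ee ab ae be pa pb pe : ℝ) (ha : aa ≠ 0) (hb : bb ≠ 0)
    (he : ee ≠ 0) (h1 : aa * bb - ab ^ 2 ≠ 0) (h2 : aa * ee - ae ^ 2 ≠ 0)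
    (h3 : bb * ee - be ^ 2 ≠ 0) (t : ℝ) :
    pe * angleRate ee aa bb ab ae be (2 * (ee - pe) * t) 0 0 0 ((ae - pa) * t) ((be - pb) * t)
      + pa * angleRate aa bb ee be ab ae 0 0 (2 * (ee - pe) * t) ((be - pb) * t) 0 ((ae - pa) * t)
      + pb * angleRate bb aa ee ae ab be 0 0 (2 * (ee - pe) * t) ((ae - pa) * t) 0 ((be - pb) * t)
      = (gramSchmidtProd ee aa ab ae be pe pa pb + gramSchmidtProd ee bb ab be ae pe pb pa) * t := by
  have r1 : aa - ae * ae / ee = (aa * ee - ae ^ 2) / ee := by field_simp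
  have r2 : bb - be * be / ee = (bb * ee - be ^ 2) / ee := by field_simp
  have r3 : bb - ab * ab / aa = (aa * bb - ab ^ 2) / aa := by field_simp
  have r4 : ee - ae * ae / aa = (aa * ee - ae ^ 2) / aa := by field_simp
  have r5 : aa - ab * ab / bb = (aa * bb - ab ^ 2) / bb := by field_simp
  have r6 : ee - be * be / bb = (bb * ee - be ^ 2) / bb := by field_simp
  simp only [angleRate, gramSchmidtProd, orthInner, r1, r2, r3, r4, r5, r6]
  -- The three 2×2 minors become nonzero atoms, so that all denominators can be cleared as monomials
  -- before the minors are expanded again.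
  generalize hu : aa * bb - ab ^ 2 = u at *
  generalize hv : aa * ee - ae ^ 2 = v at *
  generalize hw : bb * ee - be ^ 2 = w at *
  field_simp
  subst hu hv hw
  ring

/-- Here the common origin of `a, b, e` moves with velocity `-t • p`, so relative to it `a' = b' =
e' = t • p`. All three dual areas contribute. -/
theorem sum_mul_angleRate_apex (aa bb ee ab ae be pa pb pe : ℝ) (ha : aa ≠ 0) (hb : bb ≠ 0)
    (he : ee ≠ 0) (h1 : aa * bb - ab ^ 2 ≠ 0) (h2 : aa * ee - ae ^ 2 ≠ 0)
    (h3 : bb * ee - be ^ 2 ≠ 0) (t : ℝ) :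
    pe * angleRate ee aa bb ab ae be
        (2 * pe * t) (2 * pa * t) (2 * pb * t) ((pa + pb) * t) ((pa + pe) * t) ((pb + pe) * t)
      + pa * angleRate aa bb ee be ab ae
        (2 * pa * t) (2 * pb * t) (2 * pe * t) ((pb + pe) * t) ((pa + pb) * t) ((pa + pe) * t)
      + pb * angleRate bb aa ee ae ab be
        (2 * pb * t) (2 * pa * t) (2 * pe * t) ((pa + pe) * t) ((pa + pb) * t) ((pb + pe) * t)
      = (-(gramSchmidtProd ee aa ab ae be pe pa pb + gramSchmidtProd ee bb ab be ae pe pb pa)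
        - (gramSchmidtProd aa bb be ab ae pa pb pe + gramSchmidtProd aa ee be ae ab pa pe pb)
        - (gramSchmidtProd bb aa ae ab be pb pa pe + gramSchmidtProd bb ee ae be ab pb pe pa))
        * t := by
  have r1 : aa - ae * ae / ee = (aa * ee - ae ^ 2) / ee := by field_simp
  have r2 : bb - be * be / ee = (bb * ee - be ^ 2) / ee := by field_simp
  have r3 : bb - ab * ab / aa = (aa * bb - ab ^ 2) / aa := by field_simp
  have r4 : ee - ae * ae / aa = (aa * ee - ae ^ 2) / aa := by field_simp
  have r5 : aa - ab * ab / bb = (aa * bb - ab ^ 2) / bb := by field_simp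
  have r6 : ee - be * be / bb = (bb * ee - be ^ 2) / bb := by field_simp
  simp only [angleRate, gramSchmidtProd, orthInner, r1, r2, r3, r4, r5, r6]
  generalize hu : aa * bb - ab ^ 2 = u at *
  generalize hv : aa * ee - ae ^ 2 = v at *
  generalize hw : bb * ee - be ^ 2 = w at *
  field_simp
  subst hu hv hw
  ring

/-! ### Derivatives of the orthogonal inner product and of the angle. -/

theorem orthInner_mul_sub_sq {X : ℝ} (Y Z P Q R : ℝ) (hX : X ≠ 0) :
    orthInner X Y Q Q * orthInner X Z R R - orthInner X P Q R ^ 2 = gramDet X Y Z P Q R / X := by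
  unfold orthInner gramDet
  field_simp
  ring

theorem hasDerivAt_orthInner {X P Q R : ℝ → ℝ} {X' P' Q' R' t : ℝ} (hX : HasDerivAt X X' t)
    (hP : HasDerivAt P P' t) (hQ : HasDerivAt Q Q' t) (hR : HasDerivAt R R' t) (h0 : X t ≠ 0) :
    HasDerivAt (fun s => orthInner (X s) (P s) (Q s) (R s))
      (P' - (Q' * R t + Q t * R') / X t + Q t * R t * X' / X t ^ 2) t := by
  unfold orthInner
  refine (hP.sub ((hQ.mul hR).div hX h0)).congr_deriv ?_
  simp only [Pi.mul_apply]
  field_simp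
  ring

theorem hasDerivAt_arccos_div_sqrt_mul_sqrt {N A B : ℝ → ℝ} {N' A' B' t : ℝ}
    (hN : HasDerivAt N N' t) (hA : HasDerivAt A A' t) (hB : HasDerivAt B B' t)
    (hA0 : 0 < A t) (hB0 : 0 < B t) (hlt : N t ^ 2 < A t * B t) :
    HasDerivAt (fun s => Real.arccos (N s / (√(A s) * √(B s))))
      ((N t * A' / (2 * A t) + N t * B' / (2 * B t) - N') / √(A t * B t - N t ^ 2)) t := by
  have hsA := Real.sqrt_pos.2 hA0
  have hsB := Real.sqrt_pos.2 hB0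
  have hD : 0 < A t * B t - N t ^ 2 := sub_pos.2 hlt
  have hsD := Real.sqrt_pos.2 hD
  have hsq : (N t / (√(A t) * √(B t))) ^ 2 = N t ^ 2 / (A t * B t) := by
    rw [div_pow, mul_pow, Real.sq_sqrt hA0.le, Real.sq_sqrt hB0.le]
  have h1 : (N t / (√(A t) * √(B t))) ^ 2 < 1 := by
    rw [hsq, div_lt_one (by positivity)]
    exact hlt
  have hab := abs_lt.1 ((sq_lt_one_iff_abs_lt_one _).1 h1)
  have hroot : √(1 - (N t / (√(A t) * √(B t))) ^ 2) =
      √(A t * B t - N t ^ 2) / (√(A t) * √(B t)) := by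
    rw [hsq, ← Real.sqrt_mul hA0.le, ← Real.sqrt_div hD.le]
    congr 1
    field_simp
  have hq := hN.div ((hA.sqrt hA0.ne').mul (hB.sqrt hB0.ne')) (mul_pos hsA hsB).ne'
  refine ((Real.hasDerivAt_arccos hab.1.ne' hab.2.ne).comp t hq).congr_deriv ?_
  simp only [Pi.mul_apply]
  rw [hroot]
  -- With the roots of `A t` and `B t` as variables and the root of the discriminant as an atom, the
  -- comparison of derivatives is purely rational.
  obtain ⟨a, ha, haA⟩ : ∃ a, a = √(A t) ∧ A t = a ^ 2 := ⟨_, rfl, (Real.sq_sqrt hA0.le).symm⟩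
  obtain ⟨b, hb, hbB⟩ : ∃ b, b = √(B t) ∧ B t = b ^ 2 := ⟨_, rfl, (Real.sq_sqrt hB0.le).symm⟩
  rw [← ha, ← hb]
  rw [← ha] at hsA
  rw [← hb] at hsB
  generalize √(A t * B t - N t ^ 2) = D at *
  rw [haA, hbB]
  field_simp
  ring

/-! ### The Gram matrix and the dihedral angle as functions of the edge lengths. -/

/-- The length of the edge `{i, j}`, with the value `0` if `i = j`. -/
def len (ℓ : Edge → ℝ) (i j : Fin 4) : ℝ :=
  if h : i ≠ j then ℓ (edge i j h) else 0

/-- The inner product of `v j - v i` and `v k - v i` in terms of the edge lengths. -/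
def gram (ℓ : Edge → ℝ) (i j k : Fin 4) : ℝ :=
  (len ℓ i j ^ 2 + len ℓ i k ^ 2 - len ℓ j k ^ 2) / 2

theorem edge_comm (i j : Fin 4) (h : i ≠ j) : edge i j h = edge j i h.symm :=
  Subtype.ext Sym2.eq_swap

theorem len_of_ne (ℓ : Edge → ℝ) {i j : Fin 4} (h : i ≠ j) : len ℓ i j = ℓ (edge i j h) :=
  dif_pos h

theorem len_self (ℓ : Edge → ℝ) (i : Fin 4) : len ℓ i i = 0 := by simp [len]

theorem len_comm (ℓ : Edge → ℝ) (i j : Fin 4) : len ℓ i j = len ℓ j i := by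
  by_cases h : i = j
  · rw [h]
  · rw [len_of_ne ℓ h, len_of_ne ℓ (Ne.symm h), edge_comm]

theorem len_add_smul (ℓ δ : Edge → ℝ) (t : ℝ) (i j : Fin 4) :
    len (ℓ + t • δ) i j = len ℓ i j + t * len δ i j := by
  unfold len
  split_ifs <;> simp

theorem differentiable_len (i j : Fin 4) : Differentiable ℝ fun ℓ => len ℓ i j := by
  unfold len
  split_ifs <;> fun_prop

theorem differentiable_gram (i j k : Fin 4) : Differentiable ℝ fun ℓ => gram ℓ i j k := by
  have h1 := differentiable_len i j
  have h2 := differentiable_len i k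
  have h3 := differentiable_len j k
  unfold gram
  fun_prop

theorem gram_comm (ℓ : Edge → ℝ) (i j k : Fin 4) : gram ℓ i j k = gram ℓ i k j := by
  rw [gram, gram, len_comm ℓ j k]
  ring

theorem gram_self (ℓ : Edge → ℝ) (i j : Fin 4) : gram ℓ i j j = len ℓ i j ^ 2 := by
  rw [gram, len_self]
  ring

theorem hasDerivAt_gram (ℓ δ : Edge → ℝ) (i j k : Fin 4) :
    HasDerivAt (fun t : ℝ => gram (ℓ + t • δ) i j k)
      (len ℓ i j * len δ i j + len ℓ i k * len δ i k - len ℓ j k * len δ j k) 0 := by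
  have h : ∀ a b, HasDerivAt (fun t : ℝ => (len ℓ a b + t * len δ a b) ^ 2)
      (2 * (len ℓ a b * len δ a b)) 0 := by
    intro a b
    refine ((((hasDerivAt_id (0 : ℝ)).mul_const (len δ a b)).const_add
      (len ℓ a b)).pow 2).congr_deriv ?_
    simp
    ring
  simp only [gram, len_add_smul]
  refine ((((h i j).add (h i k)).sub (h j k)).div_const 2).congr_deriv ?_
  ring

theorem IsRealization.dist_eq_len {ℓ : Edge → ℝ} {v : Fin 4 → E3} (hv : IsRealization ℓ v)
    (i j : Fin 4) : dist (v i) (v j) = len ℓ i j := by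
  by_cases h : i = j
  · rw [h, dist_self, len_self]
  · rw [hv.dist_eq i j h, len_of_ne ℓ h]

theorem IsRealization.inner_eq_gram {ℓ : Edge → ℝ} {v : Fin 4 → E3} (hv : IsRealization ℓ v)
    (i j k : Fin 4) : inner ℝ (v j - v i) (v k - v i) = gram ℓ i j k := by
  rw [real_inner_eq_norm_mul_self_add_norm_mul_self_sub_norm_sub_mul_self_div_two,
    sub_sub_sub_cancel_right, ← dist_eq_norm, ← dist_eq_norm, ← dist_eq_norm,
    hv.dist_eq_len, hv.dist_eq_len, hv.dist_eq_len, gram, len_comm ℓ j i, len_comm ℓ k i]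
  ring

/-- The dihedral angle at the edge `{i, j}` as an explicit function of the edge lengths. -/
def dihedralFormula (i j k l : Fin 4) (ℓ : Edge → ℝ) : ℝ :=
  Real.arccos (orthInner (gram ℓ i j j) (gram ℓ i k l) (gram ℓ i j k) (gram ℓ i j l) /
    (√(orthInner (gram ℓ i j j) (gram ℓ i k k) (gram ℓ i j k) (gram ℓ i j k)) *
      √(orthInner (gram ℓ i j j) (gram ℓ i l l) (gram ℓ i j l) (gram ℓ i j l))))

theorem IsRealization.dihedral_eq_formula {ℓ : Edge → ℝ} {v : Fin 4 → E3}
    (hv : IsRealization ℓ v) (i j k l : Fin 4) :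
    dihedral i j k l ℓ = dihedralFormula i j k l ℓ := by
  rw [dihedral_eq hv, dihedralAngle, angle_orthogonal]
  simp only [hv.inner_eq_gram, dihedralFormula, orthInner]

theorem dihedral_swap_left (i j k l : Fin 4) : dihedral i j k l = dihedral j i k l := by
  funext ℓ
  unfold dihedral
  split_ifs with h
  · generalize h.choose = v
    have hs : (Submodule.span ℝ {v i - v j}) = Submodule.span ℝ {v j - v i} := by
      rw [← Submodule.span_neg, Set.neg_singleton, neg_sub]
    have hproj : ∀ m, (Submodule.span ℝ {v j - v i})ᗮ.starProjection (v m - v j) =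
        (Submodule.span ℝ {v j - v i})ᗮ.starProjection (v m - v i) := by
      intro m
      -- Changing the base point along the edge adds a multiple of the edge vector, which the
      -- projection kills.
      rw [← sub_sub_sub_cancel_right (v m) (v j) (v i), map_sub, sub_eq_self,
        Submodule.starProjection_apply_eq_zero_iff, Submodule.orthogonal_orthogonal]
      exact Submodule.mem_span_singleton_self _
    simp only [dihedralAngle, hs, hproj]
  · rfl

/-! ### Nondegeneracy -/

theorem gram_pos {x y z : E3} (h : LinearIndependent ℝ ![x, y, z]) :
    0 < inner ℝ x x ∧ 0 < orthInner (inner ℝ x x) (inner ℝ y y) (inner ℝ x y) (inner ℝ x y) ∧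
      0 < gramDet (inner ℝ x x) (inner ℝ y y) (inner ℝ z z) (inner ℝ y z) (inner ℝ x y)
        (inner ℝ x z) := by
  rw [Fintype.linearIndependent_iff] at h
  have hne : ∀ a b c : ℝ, a • x + b • y + c • z = 0 → a = 0 ∧ b = 0 ∧ c = 0 := by
    intro a b c habc
    have h1 := h ![a, b, c] (by simpa [Fin.sum_univ_three] using habc)
    exact ⟨h1 0, h1 1, h1 2⟩
  have hX : 0 < inner ℝ x x := by
    refine real_inner_self_pos.2 fun h0 => ?_
    simpa using (hne 1 0 0 (by simp [h0])).1
  have hXne := hX.ne'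
  set m := inner ℝ x y / inner ℝ x x with hm
  have hA : inner ℝ (y - m • x) (y - m • x) =
      orthInner (inner ℝ x x) (inner ℝ y y) (inner ℝ x y) (inner ℝ x y) := by
    simp only [inner_sub_left, inner_sub_right, real_inner_smul_left, real_inner_smul_right,
      real_inner_comm x y, hm, orthInner]
    field_simp
    ring
  have hApos : 0 < orthInner (inner ℝ x x) (inner ℝ y y) (inner ℝ x y) (inner ℝ x y) := by
    rw [← hA]
    refine real_inner_self_pos.2 fun h0 => ?_
    simpa using (hne (-m) 1 0 (by rw [← h0]; module)).2.1
  refine ⟨hX, hApos, ?_⟩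
  have hAne := hApos.ne'
  set A := orthInner (inner ℝ x x) (inner ℝ y y) (inner ℝ x y) (inner ℝ x y) with hAdef
  set n := orthInner (inner ℝ x x) (inner ℝ y z) (inner ℝ x y) (inner ℝ x z) / A with hn
  -- The third Gram-Schmidt vector; the determinant is the product of the squared norms of the three
  -- orthogonalized vectors.
  set w := z - (inner ℝ x z / inner ℝ x x) • x - n • (y - m • x) with hw
  have hwpos : 0 < inner ℝ w w := by
    refine real_inner_self_pos.2 fun h0 => ?_
    simpa using (hne (n * m - inner ℝ x z / inner ℝ x x) (-n) 1 (by rw [← h0, hw]; module)).2.2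
  have hdet : gramDet (inner ℝ x x) (inner ℝ y y) (inner ℝ z z) (inner ℝ y z) (inner ℝ x y)
      (inner ℝ x z) = inner ℝ x x * A * inner ℝ w w := by
    have hY : inner ℝ y y = A + inner ℝ x y * inner ℝ x y / inner ℝ x x := by
      rw [hAdef, orthInner]
      ring
    rw [hw]
    simp only [inner_sub_left, inner_sub_right, real_inner_smul_left, real_inner_smul_right,
      real_inner_comm x y, real_inner_comm x z, real_inner_comm y z, hn, hm, orthInner, gramDet]
    rw [hY]
    field_simp
    ring
  rw [hdet]
  positivity

theorem eq_of_inner_eq {x y z u w : E3} (h : LinearIndependent ℝ ![x, y, z])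
    (hx : inner ℝ u x = inner ℝ w x) (hy : inner ℝ u y = inner ℝ w y)
    (hz : inner ℝ u z = inner ℝ w z) : u = w := by
  have htop := h.span_eq_top_of_card_eq_finrank (by simp)
  have hmem : u - w ∈ Submodule.span ℝ (Set.range ![x, y, z]) := htop ▸ Submodule.mem_top
  have hall : ∀ q ∈ Submodule.span ℝ (Set.range ![x, y, z]), inner ℝ (u - w) q = 0 := by
    intro q hq
    induction hq using Submodule.span_induction with
    | mem q hq =>
      obtain ⟨i, rfl⟩ := hq
      fin_cases i <;> simp [inner_sub_left, hx, hy, hz]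
    | zero => simp
    | add a b _ _ ha hb => rw [inner_add_right, ha, hb, add_zero]
    | smul c a _ ha => rw [real_inner_smul_right, ha, mul_zero]
  exact sub_eq_zero.1 (inner_self_eq_zero.1 (hall _ hmem))

theorem AffineIndependent.linearIndependent_triple {v : Fin 4 → E3} (hv : AffineIndependent ℝ v)
    {i j k l : Fin 4} (h : [i, j, k, l].Nodup) :
    LinearIndependent ℝ ![v j - v i, v k - v i, v l - v i] := by
  simp only [List.nodup_cons, List.mem_cons, List.not_mem_nil, not_or, or_false] at h
  obtain ⟨⟨hij, hik, hil⟩, ⟨hjk, hjl⟩, hkl, -⟩ := h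
  have h1 := ((affineIndependent_iff_linearIndependent_vsub ℝ v i).1 hv).comp
    ![⟨j, Ne.symm hij⟩, ⟨k, Ne.symm hik⟩, ⟨l, Ne.symm hil⟩] (by
      intro a b hab
      fin_cases a <;> fin_cases b <;> simp_all [eq_comm])
  have heq : ![v j - v i, v k - v i, v l - v i] =
      (fun m : {m // m ≠ i} => (v m -ᵥ v i : E3)) ∘
        ![⟨j, Ne.symm hij⟩, ⟨k, Ne.symm hik⟩, ⟨l, Ne.symm hil⟩] := by
    ext a : 1
    fin_cases a <;> rfl
  rw [heq]
  exact h1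

theorem affineIndependent_of_linearIndependent_triple {v : Fin 4 → E3}
    (h : LinearIndependent ℝ ![v 1 - v 0, v 2 - v 0, v 3 - v 0]) : AffineIndependent ℝ v := by
  rw [affineIndependent_iff_linearIndependent_vsub ℝ v 0]
  refine (linearIndependent_equiv' (finSuccAboveEquiv (0 : Fin 4)) ?_).1 h
  ext a : 1
  fin_cases a <;> rfl

theorem IsRealization.gram_pos {ℓ : Edge → ℝ} {v : Fin 4 → E3} (hv : IsRealization ℓ v)
    {i j k l : Fin 4} (h : [i, j, k, l].Nodup) :
    0 < gram ℓ i j j ∧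
      0 < orthInner (gram ℓ i j j) (gram ℓ i k k) (gram ℓ i j k) (gram ℓ i j k) ∧
      0 < gramDet (gram ℓ i j j) (gram ℓ i k k) (gram ℓ i l l) (gram ℓ i k l) (gram ℓ i j k)
        (gram ℓ i j l) := by
  simpa only [hv.inner_eq_gram] using
    _root_.gram_pos (hv.affineIndependent.linearIndependent_triple h)

/-! ### Edge lengths near those of a nondegenerate tetrahedron -/

/-- A Gram matrix with these positivity properties has a Cholesky factorization, whose rows are the
coordinates of three vertices relative to the fourth. Positivity of `ℓ` is a separate hypothesis
because the Gram entries see only squared lengths. -/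
theorem exists_realization_of_pos {ℓ : Edge → ℝ} (hℓ : ∀ e, 0 < ℓ e)
    (h1 : 0 < gram ℓ 0 1 1)
    (h2 : 0 < orthInner (gram ℓ 0 1 1) (gram ℓ 0 2 2) (gram ℓ 0 1 2) (gram ℓ 0 1 2))
    (h3 : 0 < gramDet (gram ℓ 0 1 1) (gram ℓ 0 2 2) (gram ℓ 0 3 3) (gram ℓ 0 2 3) (gram ℓ 0 1 2)
      (gram ℓ 0 1 3)) :
    ∃ v, IsRealization ℓ v := by
  set X := gram ℓ 0 1 1 with hX
  set Y := gram ℓ 0 2 2 with hY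
  set Z := gram ℓ 0 3 3 with hZ
  set P := gram ℓ 0 2 3 with hP
  set Q := gram ℓ 0 1 2 with hQ
  set R := gram ℓ 0 1 3 with hR
  set A := orthInner X Y Q Q with hA
  obtain ⟨s, hs, hsX⟩ : ∃ s, 0 < s ∧ s ^ 2 = X := ⟨√X, Real.sqrt_pos.2 h1, Real.sq_sqrt h1.le⟩
  obtain ⟨t, ht, htA⟩ : ∃ t, 0 < t ∧ t ^ 2 = A := ⟨√A, Real.sqrt_pos.2 h2, Real.sq_sqrt h2.le⟩
  have hD : 0 < gramDet X Y Z P Q R / (X * A) := by positivity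
  obtain ⟨r, hr, hrD⟩ : ∃ r, 0 < r ∧ r ^ 2 = gramDet X Y Z P Q R / (X * A) :=
    ⟨_, Real.sqrt_pos.2 hD, Real.sq_sqrt hD.le⟩
  set N := orthInner X P Q R with hN
  -- The diagonal entries `s, t, r` are the norms of the Gram-Schmidt vectors; the entries below
  -- them are forced by the inner products `Q`, `R` and `P`.
  let v : Fin 4 → E3 := ![0, !₂[s, 0, 0], !₂[Q / s, t, 0], !₂[R / s, N / t, r]]
  have hYA : Y = t ^ 2 + Q ^ 2 / s ^ 2 := by
    rw [htA, hA, orthInner, hsX]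
    ring
  have hPN : P = N + Q * R / s ^ 2 := by
    rw [hN, orthInner, hsX]
    ring
  have hZr : Z = r ^ 2 + R ^ 2 / s ^ 2 + N ^ 2 / t ^ 2 := by
    rw [hrD, htA, hsX, hN, gramDet]
    have hYA' : Y = A + Q * Q / X := by rw [hA, orthInner]; ring
    rw [hYA', orthInner]
    field_simp
    ring
  have hsq : ∀ i j, dist (v i) (v j) ^ 2 = len ℓ i j ^ 2 := by
    have key : ∀ i j, i < j → dist (v i) (v j) ^ 2 = len ℓ i j ^ 2 := by
      have e1 : len ℓ 0 1 ^ 2 = X := by rw [← gram_self]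
      have e2 : len ℓ 0 2 ^ 2 = Y := by rw [← gram_self]
      have e3 : len ℓ 0 3 ^ 2 = Z := by rw [← gram_self]
      have e4 : len ℓ 1 2 ^ 2 = X + Y - 2 * Q := by rw [hQ, gram, ← e1, ← e2]; ring
      have e5 : len ℓ 1 3 ^ 2 = X + Z - 2 * R := by rw [hR, gram, ← e1, ← e3]; ring
      have e6 : len ℓ 2 3 ^ 2 = Y + Z - 2 * P := by rw [hP, gram, ← e2, ← e3]; ring
      have hdist : ∀ a b : E3, dist a b ^ 2 =
          (a 0 - b 0) ^ 2 + (a 1 - b 1) ^ 2 + (a 2 - b 2) ^ 2 := by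
        intro a b
        rw [EuclideanSpace.dist_eq, Real.sq_sqrt (by positivity), Fin.sum_univ_three]
        simp [Real.dist_eq]
      intro i j hij
      rw [hdist]
      fin_cases i <;> fin_cases j <;> first | exact absurd hij (by decide) | skip
      · exact Eq.trans (by simp [v, hsX]) e1.symm
      · exact Eq.trans (by simp [v]; rw [hYA]; ring) e2.symm
      · exact Eq.trans (by simp [v]; rw [hZr]; ring) e3.symm
      · exact Eq.trans (by simp [v]; rw [hYA, ← hsX]; field_simp; ring) e4.symm
      · exact Eq.trans (by simp [v]; rw [hZr, ← hsX]; field_simp; ring) e5.symm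
      · exact Eq.trans (by simp [v]; rw [hZr, hYA, hPN]; field_simp; ring) e6.symm
    intro i j
    rcases lt_trichotomy i j with h | h | h
    · exact key i j h
    · rw [h, dist_self, len_self]
    · rw [dist_comm, len_comm]
      exact key j i h
  refine ⟨v, affineIndependent_of_linearIndependent_triple ?_, fun i j h => ?_⟩
  · rw [Fintype.linearIndependent_iff]
    intro g hg
    -- The coordinate matrix is triangular with nonzero diagonal, so the coefficients vanish from
    -- the last coordinate backwards.
    have g0 := congrArg (fun u : E3 => u 0) hg
    have g1 := congrArg (fun u : E3 => u 1) hg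
    have g2 := congrArg (fun u : E3 => u 2) hg
    simp [v, Fin.sum_univ_three, hr.ne'] at g0 g1 g2
    simp [g2, ht.ne'] at g1
    simp [g2, g1, hs.ne'] at g0
    intro i
    fin_cases i
    · exact g0
    · exact g1
    · exact g2
  · have h1 := hsq i j
    rw [len_of_ne ℓ h] at h1
    exact (sq_eq_sq₀ dist_nonneg (hℓ _).le).1 h1

theorem Edge.exists_eq_edge (e : Edge) : ∃ i j, ∃ h : i ≠ j, e = edge i j h := by
  obtain ⟨e, he⟩ := e
  induction e using Sym2.ind with
  | _ i j => exact ⟨i, j, by simpa using he, rfl⟩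

/-- Realizability follows from finitely many strict inequalities between functions continuous at
`ℓ`. So `dihedral` agrees with its explicit formula on a whole neighborhood and can be
differentiated through it. -/
theorem IsRealization.eventually_exists {ℓ : Edge → ℝ} {v : Fin 4 → E3}
    (hv : IsRealization ℓ v) : ∀ᶠ ℓ' in nhds ℓ, ∃ w, IsRealization ℓ' w := by
  have hg : ∀ i j k, ContinuousAt (fun ℓ => gram ℓ i j k) ℓ := fun i j k =>
    (differentiable_gram i j k).continuous.continuousAt
  have hpos : ∀ e, 0 < ℓ e := by
    intro e
    obtain ⟨i, j, h, rfl⟩ := e.exists_eq_edge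
    rw [← hv.dist_eq i j h]
    exact dist_pos.2 fun h' => h (hv.affineIndependent.injective h')
  obtain ⟨h1, h2, h3⟩ := hv.gram_pos (i := 0) (j := 1) (k := 2) (l := 3) (by decide)
  have c2 : ContinuousAt (fun ℓ => orthInner (gram ℓ 0 1 1) (gram ℓ 0 2 2) (gram ℓ 0 1 2)
      (gram ℓ 0 1 2)) ℓ :=
    (hg 0 2 2).sub (((hg 0 1 2).mul (hg 0 1 2)).div (hg 0 1 1) h1.ne')
  have c3 : ContinuousAt (fun ℓ => gramDet (gram ℓ 0 1 1) (gram ℓ 0 2 2) (gram ℓ 0 3 3)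
      (gram ℓ 0 2 3) (gram ℓ 0 1 2) (gram ℓ 0 1 3)) ℓ := by
    unfold gramDet
    fun_prop
  have hev : ∀ᶠ ℓ' in nhds ℓ, ∀ e, 0 < ℓ' e :=
    Filter.eventually_all.2 fun e => (continuous_apply e).continuousAt.eventually_const_lt (hpos e)
  filter_upwards [hev, (hg 0 1 1).eventually_const_lt h1, c2.eventually_const_lt h2,
    c3.eventually_const_lt h3] with ℓ' a1 a2 a3 a4
  exact exists_realization_of_pos a1 a2 a3 a4

theorem IsRealization.dihedral_eventuallyEq {ℓ : Edge → ℝ} {v : Fin 4 → E3}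
    (hv : IsRealization ℓ v) (i j k l : Fin 4) :
    dihedral i j k l =ᶠ[nhds ℓ] dihedralFormula i j k l := by
  filter_upwards [hv.eventually_exists] with ℓ' ⟨w, hw⟩
  exact hw.dihedral_eq_formula i j k l

/-! ### Differentiability and derivative of the dihedral angle. -/

theorem swap_nodup {i j k l : Fin 4} (h : [i, j, k, l].Nodup) : [i, j, l, k].Nodup := by
  simp only [List.nodup_cons, List.mem_cons, List.not_mem_nil] at h ⊢
  tauto

theorem gramDet_swap (X Y Z P Q R : ℝ) : gramDet X Y Z P Q R = gramDet X Z Y P R Q := by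
  unfold gramDet
  ring

theorem IsRealization.orthInner_sq_lt {ℓ : Edge → ℝ} {v : Fin 4 → E3} (hv : IsRealization ℓ v)
    {i j k l : Fin 4} (h : [i, j, k, l].Nodup) :
    orthInner (gram ℓ i j j) (gram ℓ i k l) (gram ℓ i j k) (gram ℓ i j l) ^ 2 <
      orthInner (gram ℓ i j j) (gram ℓ i k k) (gram ℓ i j k) (gram ℓ i j k) *
        orthInner (gram ℓ i j j) (gram ℓ i l l) (gram ℓ i j l) (gram ℓ i j l) := by
  obtain ⟨h1, -, h3⟩ := hv.gram_pos h
  rw [← sub_pos, orthInner_mul_sub_sq _ _ _ _ _ h1.ne']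
  positivity

theorem IsRealization.differentiableAt_dihedral {ℓ : Edge → ℝ} {v : Fin 4 → E3}
    (hv : IsRealization ℓ v) {i j k l : Fin 4} (h : [i, j, k, l].Nodup) :
    DifferentiableAt ℝ (dihedral i j k l) ℓ := by
  refine DifferentiableAt.congr_of_eventuallyEq ?_ (hv.dihedral_eventuallyEq i j k l)
  obtain ⟨h1, h2, -⟩ := hv.gram_pos h
  obtain ⟨-, h3, -⟩ := hv.gram_pos (swap_nodup h)
  have hlt := hv.orthInner_sq_lt h
  have hd : ∀ a b c d, DifferentiableAt ℝ
      (fun ℓ => orthInner (gram ℓ i j j) (gram ℓ i a b) (gram ℓ i j c) (gram ℓ i j d)) ℓ :=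
    fun a b c d => by
      simp only [orthInner, div_eq_mul_inv]
      exact (differentiable_gram i a b ℓ).fun_sub
        (((differentiable_gram i j c ℓ).fun_mul (differentiable_gram i j d ℓ)).fun_mul
          ((differentiable_gram i j j ℓ).fun_inv h1.ne'))
  have hq := (hd k l k l).fun_mul ((((hd k k k k).sqrt h2.ne').fun_mul
    ((hd l l l l).sqrt h3.ne')).fun_inv (mul_pos (Real.sqrt_pos.2 h2) (Real.sqrt_pos.2 h3)).ne')
  simp only [← div_eq_mul_inv] at hq
  refine DifferentiableAt.comp ℓ (Real.differentiableAt_arccos.2 ?_) hq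
  have hsq : (orthInner (gram ℓ i j j) (gram ℓ i k l) (gram ℓ i j k) (gram ℓ i j l) /
      (√(orthInner (gram ℓ i j j) (gram ℓ i k k) (gram ℓ i j k) (gram ℓ i j k)) *
        √(orthInner (gram ℓ i j j) (gram ℓ i l l) (gram ℓ i j l) (gram ℓ i j l)))) ^ 2 < 1 := by
    rw [div_pow, mul_pow, Real.sq_sqrt h2.le, Real.sq_sqrt h3.le, div_lt_one (by positivity)]
    exact hlt
  have hab := abs_lt.1 ((sq_lt_one_iff_abs_lt_one _).1 hsq)
  exact ⟨hab.1.ne', hab.2.ne⟩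

/-- The derivative of `gram` in the direction `δ`. -/
def gramDeriv (ℓ δ : Edge → ℝ) (i j k : Fin 4) : ℝ :=
  len ℓ i j * len δ i j + len ℓ i k * len δ i k - len ℓ j k * len δ j k

theorem IsRealization.fderiv_dihedral {ℓ : Edge → ℝ} {v : Fin 4 → E3}
    (hv : IsRealization ℓ v) {i j k l : Fin 4} (h : [i, j, k, l].Nodup) (δ : Edge → ℝ) :
    fderiv ℝ (dihedral i j k l) ℓ δ = len ℓ i j *
      angleRate (gram ℓ i j j) (gram ℓ i k k) (gram ℓ i l l) (gram ℓ i k l) (gram ℓ i j k)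
        (gram ℓ i j l) (gramDeriv ℓ δ i j j) (gramDeriv ℓ δ i k k) (gramDeriv ℓ δ i l l)
        (gramDeriv ℓ δ i k l) (gramDeriv ℓ δ i j k) (gramDeriv ℓ δ i j l) /
      √(gramDet (gram ℓ i j j) (gram ℓ i k k) (gram ℓ i l l) (gram ℓ i k l) (gram ℓ i j k)
        (gram ℓ i j l)) := by
  obtain ⟨h1, h2, h4⟩ := hv.gram_pos h
  obtain ⟨-, h3, -⟩ := hv.gram_pos (swap_nodup h)
  have hlt := hv.orthInner_sq_lt h
  -- Since the function is differentiable, its differential on `δ` can be computed along the line `ℓ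
  -- + t • δ`.
  rw [(hv.dihedral_eventuallyEq i j k l).fderiv_eq,
    ← DifferentiableAt.lineDeriv_eq_fderiv ((hv.differentiableAt_dihedral h).congr_of_eventuallyEq
      (hv.dihedral_eventuallyEq i j k l).symm)]
  have hg : ∀ a b c, HasDerivAt (fun t : ℝ => gram (ℓ + t • δ) a b c) (gramDeriv ℓ δ a b c) 0 :=
    hasDerivAt_gram ℓ δ
  have hz : ℓ + (0 : ℝ) • δ = ℓ := by simp
  have hX : gram (ℓ + (0 : ℝ) • δ) i j j ≠ 0 := by rw [hz]; exact h1.ne'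
  have hN := hasDerivAt_orthInner (hg i j j) (hg i k l) (hg i j k) (hg i j l) hX
  have hA := hasDerivAt_orthInner (hg i j j) (hg i k k) (hg i j k) (hg i j k) hX
  have hB := hasDerivAt_orthInner (hg i j j) (hg i l l) (hg i j l) (hg i j l) hX
  have key := hasDerivAt_arccos_div_sqrt_mul_sqrt hN hA hB (by rwa [hz]) (by rwa [hz])
    (by rwa [hz])
  have key' : HasLineDerivAt ℝ (dihedralFormula i j k l) _ ℓ δ := key
  refine key'.lineDeriv.trans ?_
  simp only [hz]
  -- The root in the derivative of the arccosine is that of `gramDet / ℓ_ij ^ 2`; this is where the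
  -- factor `ℓ_ij` comes from.
  rw [orthInner_mul_sub_sq _ _ _ _ _ h1.ne', Real.sqrt_div h4.le, gram_self ℓ i j, Real.sqrt_sq]
  · rw [div_div_eq_mul_div, mul_comm (len ℓ i j)]
    simp only [angleRate, orthInner]
  · rw [← hv.dist_eq_len]
    exact dist_nonneg

/-! ### Signed heights -/

open Classical in
-- Turns a signed distance into a coefficient: `p` and `q` are feet in `s`, and the displacement of
-- `y` from `q` is `t` times that of `x` from `p`.
theorem ite_sSameSide_dist {s : AffineSubspace ℝ E3} {x y p q : E3} (hx : x ∉ s) (hp : p ∈ s)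
    (hq : q ∈ s) {t : ℝ} (hy : y = t • (x - p) + q) :
    (if s.SSameSide y x then dist y q else -dist y q) = t * ‖x - p‖ := by
  have hdist : dist y q = |t| * ‖x - p‖ := by
    rw [dist_eq_norm, hy, add_sub_cancel_right, norm_smul, Real.norm_eq_abs]
  rw [hdist]
  subst hy
  rcases lt_trichotomy t 0 with ht | ht | ht
  · rw [if_neg, abs_of_neg ht, neg_mul, neg_neg]
    exact (AffineSubspace.sOppSide_smul_vsub_vadd_left hx hp hq ht).not_sSameSide
  -- Here `y = q` lies in `s`, and both branches of the sign convention give zero.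
  · simp [ht]
  · rw [if_pos, abs_of_pos ht]
    exact AffineSubspace.sSameSide_smul_vsub_vadd_left hx hp hq ht

theorem mem_affineSpan_triple {u v w q : E3} :
    q ∈ affineSpan ℝ {u, v, w} ↔ ∃ a b : ℝ, q = u + a • (v - u) + b • (w - u) := by
  have hu : u ∈ ({u, v, w} : Set E3) := by simp
  rw [← AffineSubspace.vsub_right_mem_direction_iff_mem (subset_affineSpan ℝ _ hu),
    direction_affineSpan, vectorSpan_eq_span_vsub_set_right ℝ hu]
  simp only [Set.image_insert_eq, Set.image_singleton, vsub_eq_sub, sub_self,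
    Submodule.mem_span_triple, smul_zero, zero_add]
  constructor
  · rintro ⟨-, a, b, h⟩
    exact ⟨a, b, by rw [add_assoc, h]; abel⟩
  · rintro ⟨a, b, rfl⟩
    exact ⟨0, a, b, by abel⟩

theorem notMem_affineSpan_triple {u v w q : E3}
    (h : LinearIndependent ℝ ![v - u, w - u, q - u]) : q ∉ affineSpan ℝ {u, v, w} := by
  rw [mem_affineSpan_triple]
  rintro ⟨a, b, hq⟩
  rw [Fintype.linearIndependent_iff] at h
  have h1 := h ![a, b, -1] (by
    have : q - u = a • (v - u) + b • (w - u) := by rw [hq]; abel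
    simp [Fin.sum_univ_three, this]
    abel) 2
  simp at h1

/-! ### Centers, heights and dual areas in terms of Gram entries. -/

section Center

variable {d : Fin 4 → Fin 4 → ℝ} {v : Fin 4 → E3}

theorem isCenter_center (hd : IsMetric d) (hv : IsRealization (edgeLength d) v)
    {s : Finset (Fin 4)} (hs : s.Nonempty) : IsCenter v d s (center v d s) :=
  Classical.epsilon_spec (existsUnique_center hd hv s hs).exists

theorem len_edgeLength_pos (hv : IsRealization (edgeLength d) v) {i j : Fin 4} (h : i ≠ j) :
    0 < len (edgeLength d) i j := by
  rw [← hv.dist_eq_len]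
  exact dist_pos.2 fun h' => h (hv.affineIndependent.injective h')

theorem inner_center_sub (hd : IsMetric d) (hv : IsRealization (edgeLength d) v)
    {s : Finset (Fin 4)} {i j : Fin 4} (hi : i ∈ s) (hj : j ∈ s) (h : i ≠ j) :
    inner ℝ (center v d s - v i) (v j - v i) = d i j * len (edgeLength d) i j := by
  have hlen : len (edgeLength d) i j = d i j + d j i := by
    rw [len_of_ne _ h, edgeLength_edge]
  have h0 := (len_edgeLength_pos hv h).ne'
  have h1 := (isCenter_center hd hv ⟨i, hi⟩).orthogonal i hi j hj h
  have h2 : edgeCenter v d i j - v i = (d i j / len (edgeLength d) i j) • (v j - v i) := by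
    simp [edgeCenter, AffineMap.lineMap_apply, hlen]
  rw [← sub_sub_sub_cancel_right _ _ (v i), h2, inner_sub_left, real_inner_smul_left,
    real_inner_self_eq_norm_sq, ← dist_eq_norm, dist_comm, hv.dist_eq_len] at h1
  rw [sub_eq_zero.1 h1]
  field_simp

theorem edgeCenter_comm (hv : IsRealization (edgeLength d) v) {i j : Fin 4} (h : i ≠ j) :
    edgeCenter v d i j = edgeCenter v d j i := by
  have h0 := (len_edgeLength_pos hv h).ne'
  rw [len_of_ne _ h, edgeLength_edge] at h0
  rw [edgeCenter, edgeCenter, ← AffineMap.lineMap_apply_one_sub]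
  congr 1
  rw [add_comm (d j i)]
  field_simp
  ring

theorem dualArea_comm (hv : IsRealization (edgeLength d) v) {i j : Fin 4} (h : i ≠ j)
    (k l : Fin 4) : dualArea v d i j k l = dualArea v d j i k l := by
  have hE : ∀ m, hEdge v d i j m = hEdge v d j i m := fun m => by
    rw [hEdge, hEdge, Set.pair_comm, Finset.insert_comm, edgeCenter_comm hv h]
  have hF : ∀ m n, hFace v d i j m n = hFace v d j i m n := fun m n => by
    rw [hFace, hFace, Set.insert_comm, Finset.insert_comm]
  rw [dualArea, dualArea, hE, hE, hF, hF]

/-- The inner product of `c_1234 - v i` and `v j - v i`. -/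
def centerInner (v : Fin 4 → E3) (d : Fin 4 → Fin 4 → ℝ) (i j : Fin 4) : ℝ :=
  inner ℝ (center v d Finset.univ - v i) (v j - v i)

theorem centerInner_eq (hd : IsMetric d) (hv : IsRealization (edgeLength d) v) {i j : Fin 4}
    (h : i ≠ j) : centerInner v d i j = d i j * len (edgeLength d) i j :=
  inner_center_sub hd hv (Finset.mem_univ i) (Finset.mem_univ j) h

/-- Orthogonalize the edge vectors `x, y, z` at `v i` to `x, y', z'`. The face center is the
orthogonal projection of `c_1234` to the face and the edge center its projection to the edge, so the
two heights are the components of `c_1234 - v i` along the unit vectors of `y'` and `z'`. The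
product of the three norms is the root of the Gram determinant. -/
theorem hEdge_mul_hFace (hd : IsMetric d) (hv : IsRealization (edgeLength d) v)
    {i j k l : Fin 4} (h : [i, j, k, l].Nodup) :
    hEdge v d i j k * hFace v d i j k l = len (edgeLength d) i j *
      gramSchmidtProd (gram (edgeLength d) i j j) (gram (edgeLength d) i k k)
        (gram (edgeLength d) i k l) (gram (edgeLength d) i j k) (gram (edgeLength d) i j l)
        (centerInner v d i j) (centerInner v d i k) (centerInner v d i l) /
      √(gramDet (gram (edgeLength d) i j j) (gram (edgeLength d) i k k)
        (gram (edgeLength d) i l l) (gram (edgeLength d) i k l) (gram (edgeLength d) i j k)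
        (gram (edgeLength d) i j l)) := by
  have hli := hv.affineIndependent.linearIndependent_triple h
  have hli' := hv.affineIndependent.linearIndependent_triple (swap_nodup h)
  obtain ⟨hX, hA, hD⟩ := hv.gram_pos h
  simp only [List.nodup_cons, List.mem_cons, List.not_mem_nil, not_or, or_false] at h
  obtain ⟨⟨hij, hik, -⟩, ⟨-, -⟩, -, -⟩ := h
  have hlen := len_edgeLength_pos hv hij
  have hXlen : gram (edgeLength d) i j j = len (edgeLength d) i j ^ 2 := gram_self _ _ _
  have hxx := hv.inner_eq_gram i j j
  have hyy := hv.inner_eq_gram i k k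
  have hzz := hv.inner_eq_gram i l l
  have hxy := hv.inner_eq_gram i j k
  have hxz := hv.inner_eq_gram i j l
  have hyz := hv.inner_eq_gram i k l
  -- The face center and `c_1234` have the same inner products with the edges of the face.
  have hcx : inner ℝ (center v d {i, j, k} - v i) (v j - v i) = centerInner v d i j := by
    rw [centerInner_eq hd hv hij, inner_center_sub hd hv (by simp) (by simp) hij]
  have hcy : inner ℝ (center v d {i, j, k} - v i) (v k - v i) = centerInner v d i k := by
    rw [centerInner_eq hd hv hik, inner_center_sub hd hv (by simp) (by simp) hik]
  have hec : edgeCenter v d i j =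
      v i + (centerInner v d i j / gram (edgeLength d) i j j) • (v j - v i) := by
    rw [edgeCenter, AffineMap.lineMap_apply, vsub_eq_sub, vadd_eq_add, add_comm, hXlen,
      centerInner_eq hd hv hij]
    congr 2
    rw [← edgeLength_edge d i j hij, ← len_of_ne (edgeLength d) hij]
    field_simp
  obtain ⟨a, b, hc⟩ := mem_affineSpan_triple.1 (show center v d {i, j, k} ∈
      affineSpan ℝ {v i, v j, v k} by
    simpa [Set.image_insert_eq] using
      (isCenter_center hd hv (s := {i, j, k}) ⟨i, by simp⟩).mem_span)
  have hkline : v k ∉ affineSpan ℝ {v i, v j} := fun hk =>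
    notMem_affineSpan_triple hli' (affineSpan_mono ℝ (by intro; simp; tauto) hk)
  have hlplane := notMem_affineSpan_triple hli
  have hpx : inner ℝ (center v d Finset.univ - v i) (v j - v i) = centerInner v d i j := rfl
  have hpy : inner ℝ (center v d Finset.univ - v i) (v k - v i) = centerInner v d i k := rfl
  have hpz : inner ℝ (center v d Finset.univ - v i) (v l - v i) = centerInner v d i l := rfl
  rw [hEdge, hFace]
  rw [hec]
  generalize center v d {i, j, k} = c at *
  generalize center v d Finset.univ = p at *
  generalize centerInner v d i j = px at *
  generalize centerInner v d i k = py at *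
  generalize centerInner v d i l = pz at *
  generalize gram (edgeLength d) i j j = X at *
  generalize gram (edgeLength d) i k k = Y at *
  generalize gram (edgeLength d) i l l = Z at *
  generalize gram (edgeLength d) i k l = P at *
  generalize gram (edgeLength d) i j k = Q at *
  generalize gram (edgeLength d) i j l = R at *
  generalize len (edgeLength d) i j = L at *
  obtain ⟨x, hx⟩ : ∃ x, x = v j - v i := ⟨_, rfl⟩
  obtain ⟨y, hy⟩ : ∃ y, y = v k - v i := ⟨_, rfl⟩
  obtain ⟨z, hz⟩ : ∃ z, z = v l - v i := ⟨_, rfl⟩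
  rw [← hx, ← hy, ← hz] at hli
  rw [← hx] at hxx hxy hxz hcx hpx hc ⊢
  rw [← hy] at hxy hyy hyz hcy hpy hc
  rw [← hz] at hxz hyz hzz hpz
  have hyx : inner ℝ y x = Q := by rw [real_inner_comm, hxy]
  have hzx : inner ℝ z x = R := by rw [real_inner_comm, hxz]
  have hzy : inner ℝ z y = P := by rw [real_inner_comm, hyz]
  have hAdef : orthInner X Y Q Q = Y - Q * Q / X := rfl
  generalize hAg : orthInner X Y Q Q = A at *
  -- The entries `Y, P, Z` are rewritten in Gram-Schmidt data: `A` and `B` are the squared norms of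
  -- `y'` and `z'`, and `n` is the coefficient of `y'` in `z`.
  have hYA : Y = A + Q * Q / X := by rw [hAdef]; ring
  obtain ⟨n, hn⟩ : ∃ n, n = orthInner X P Q R / A := ⟨_, rfl⟩
  have hPn : P = n * A + Q * R / X := by rw [hn, orthInner]; field_simp; ring
  obtain ⟨B, hB⟩ : ∃ B, B = gramDet X Y Z P Q R / (X * A) := ⟨_, rfl⟩
  have hBpos : 0 < B := by rw [hB]; positivity
  have hZB : Z = B + R * R / X + n * n * A := by
    rw [hB, gramDet, hYA, hPn]
    field_simp
    ring
  obtain ⟨y', hy'⟩ : ∃ y', y' = y - (Q / X) • x := ⟨_, rfl⟩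
  obtain ⟨z', hz'⟩ : ∃ z', z' = z - (R / X) • x - n • y' := ⟨_, rfl⟩
  obtain ⟨py', hpy'⟩ : ∃ py', py' = py - Q / X * px := ⟨_, rfl⟩
  obtain ⟨pz', hpz'⟩ : ∃ pz', pz' = pz - R / X * px - n * py' := ⟨_, rfl⟩
  have hny : ‖y'‖ = √A := by
    rw [norm_eq_sqrt_real_inner, hy']
    simp only [inner_sub_left, inner_sub_right, real_inner_smul_left, real_inner_smul_right,
      hxx, hyy, hxy, hyx, hYA]
    congr 1
    field_simp
    ring
  have hnz : ‖z'‖ = √B := by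
    rw [norm_eq_sqrt_real_inner, hz', hy']
    simp only [inner_sub_left, inner_sub_right, real_inner_smul_left, real_inner_smul_right,
      hxx, hyy, hzz, hxy, hyx, hxz, hzx, hyz, hzy, hYA, hPn, hZB]
    congr 1
    field_simp
    ring
  have hface : c = v i + (px / X) • x + (py' / A) • y' := by
    rw [hc, add_assoc, add_sub_cancel_left, inner_add_left, real_inner_smul_left,
      real_inner_smul_left] at hcx hcy
    rw [hxx, hyx] at hcx
    rw [hxy, hyy] at hcy
    have hb : b = py' / A := by
      rw [hpy', ← hcx, ← hcy, hYA]
      field_simp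
      ring
    have ha : a = px / X - b * (Q / X) := by
      rw [← hcx]
      field_simp
      ring
    rw [hc, ← hb, ha, hy']
    module
  have hcenter : p - v i = (px / X) • x + (py' / A) • y' + (pz' / B) • z' := by
    refine eq_of_inner_eq hli ?_ ?_ ?_
    · rw [hpx, hz', hy']
      simp only [inner_add_left, inner_sub_left, real_inner_smul_left, hxx, hyx, hzx]
      field_simp
      ring
    · rw [hpy, hz', hy']
      simp only [inner_add_left, inner_sub_left, real_inner_smul_left, hxy, hyy, hzy, hYA, hPn,
        hpy']
      field_simp
      ring
    · rw [hpz, hz', hy']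
      simp only [inner_add_left, inner_sub_left, real_inner_smul_left, hxz, hyz, hzz, hPn, hZB,
        hpz', hpy']
      field_simp
      ring
  have hline : ∀ t : ℝ, v i + t • x ∈ affineSpan ℝ {v i, v j} := fun t => by
    have := AffineMap.lineMap_mem_affineSpan_pair t (v i) (v j)
    rwa [AffineMap.lineMap_apply, vsub_eq_sub, vadd_eq_add, add_comm, ← hx] at this
  have hplane : ∀ s t : ℝ, v i + s • x + t • y' ∈ affineSpan ℝ {v i, v j, v k} := fun s t => by
    refine mem_affineSpan_triple.2 ⟨s - t * (Q / X), t, ?_⟩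
    rw [← hx, ← hy, hy']
    module
  have hyk : v k - (v i + (Q / X) • x) = y' := by rw [hy', hy]; abel
  have hzl : v l - (v i + (R / X) • x + n • y') = z' := by rw [hz', hz]; abel
  -- The comparison points are the feet of the perpendiculars from `v k` to the line and from `v l`
  -- to the plane, so the reference displacements are exactly `y'` and `z'`.
  rw [ite_sSameSide_dist hkline (hline (Q / X)) (hline (px / X)) (t := py' / A)
      (by rw [hface, hyk]; abel),
    ite_sSameSide_dist hlplane (hplane (R / X) n) (hface ▸ hplane _ _) (t := pz' / B)
      (by rw [hface, hzl, ← sub_add_cancel p (v i), hcenter]; abel), hyk, hzl, hny, hnz]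
  have hprod : gramSchmidtProd X Y P Q R px py pz = py' * pz' := by
    rw [gramSchmidtProd, hAg, ← hn, ← hpy', ← hpz']
  have hDAB : gramDet X Y Z P Q R = L ^ 2 * (A * B) := by
    rw [hB, ← hXlen]
    field_simp
  rw [hprod, hDAB, Real.sqrt_mul (by positivity), Real.sqrt_sq hlen.le, Real.sqrt_mul hA.le]
  nth_rewrite 1 [← Real.sq_sqrt hA.le]
  nth_rewrite 1 [← Real.sq_sqrt hBpos.le]
  have := Real.sqrt_pos.2 hA
  have := Real.sqrt_pos.2 hBpos
  field_simp

theorem two_mul_dualArea_div (hd : IsMetric d) (hv : IsRealization (edgeLength d) v)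
    {i j k l : Fin 4} (h : [i, j, k, l].Nodup) :
    2 * (dualArea v d i j k l / len (edgeLength d) i j) =
      (gramSchmidtProd (gram (edgeLength d) i j j) (gram (edgeLength d) i k k)
        (gram (edgeLength d) i k l) (gram (edgeLength d) i j k) (gram (edgeLength d) i j l)
        (centerInner v d i j) (centerInner v d i k) (centerInner v d i l) +
      gramSchmidtProd (gram (edgeLength d) i j j) (gram (edgeLength d) i l l)
        (gram (edgeLength d) i k l) (gram (edgeLength d) i j l) (gram (edgeLength d) i j k)
        (centerInner v d i j) (centerInner v d i l) (centerInner v d i k)) /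
      √(gramDet (gram (edgeLength d) i j j) (gram (edgeLength d) i k k)
        (gram (edgeLength d) i l l) (gram (edgeLength d) i k l) (gram (edgeLength d) i j k)
        (gram (edgeLength d) i j l)) := by
  have hlen : 0 < len (edgeLength d) i j := len_edgeLength_pos hv (by
    simp only [List.nodup_cons, List.mem_cons, not_or] at h
    exact h.1.1)
  rw [dualArea, hEdge_mul_hFace hd hv h, hEdge_mul_hFace hd hv (swap_nodup h),
    gram_comm _ i l k, gramDet_swap _ (gram (edgeLength d) i l l)]
  field_simp

end Center

/-! ### Variation of the dihedral angles -/

theorem IsRealization.gram_mul_sub_sq_ne_zero {ℓ : Edge → ℝ} {v : Fin 4 → E3}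
    (hv : IsRealization ℓ v) {i j k l : Fin 4} (h : [i, j, k, l].Nodup) :
    gram ℓ i j j * gram ℓ i k k - gram ℓ i j k ^ 2 ≠ 0 := by
  obtain ⟨hX, hA, -⟩ := hv.gram_pos h
  have h1 : gram ℓ i j j * gram ℓ i k k - gram ℓ i j k ^ 2 = gram ℓ i j j *
      orthInner (gram ℓ i j j) (gram ℓ i k k) (gram ℓ i j k) (gram ℓ i j k) := by
    unfold orthInner
    field_simp
  rw [h1]
  positivity

/-- With `c` the center, both sides express `⟪v j - v i, v l - c⟫`, once through inner products at
`v l` and once at `v i`. Algebraically this is half the compatibility condition on the face `i j l`.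
-/
theorem IsMetric.len_mul_sub_len_mul {d : Fin 4 → Fin 4 → ℝ} (hd : IsMetric d) {i j l : Fin 4}
    (hij : i ≠ j) (hjl : j ≠ l) (hil : i ≠ l) :
    len (edgeLength d) i l * d l i - len (edgeLength d) j l * d l j =
      gram (edgeLength d) i j l - d i j * len (edgeLength d) i j := by
  rw [gram, len_of_ne _ hij, len_of_ne _ hjl, len_of_ne _ hil, edgeLength_edge, edgeLength_edge,
    edgeLength_edge]
  linear_combination (1 / 2) * hd.compat i j l hij hjl hil.symm

section Variation

variable {d : Fin 4 → Fin 4 → ℝ} {v : Fin 4 → E3} {δ : Edge → ℝ} {t : ℝ} {i j k l : Fin 4}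

/-- The variation of the angles at the edges through a vertex `i` of the fixed face `i j k`. -/
theorem sum_fderiv_dihedral_base (hd : IsMetric d) (hv : IsRealization (edgeLength d) v)
    (h : [i, j, k, l].Nodup) (hij : len δ i j = 0) (hik : len δ i k = 0) (hjk : len δ j k = 0)
    (hl : ∀ m, m ≠ l → len δ m l = d l m * t) :
    d i l * fderiv ℝ (dihedral i l j k) (edgeLength d) δ
      + d i j * fderiv ℝ (dihedral i j k l) (edgeLength d) δ
      + d i k * fderiv ℝ (dihedral i k j l) (edgeLength d) δ
      = 2 * (dualArea v d i l j k / len (edgeLength d) i l) * t := by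
  have hl_jk : [i, l, j, k].Nodup := by
    simp only [List.nodup_cons, List.mem_cons, List.not_mem_nil] at h ⊢; tauto
  have hk_jl : [i, k, j, l].Nodup := by
    simp only [List.nodup_cons, List.mem_cons, List.not_mem_nil] at h ⊢; tauto
  have hj_lk : [i, j, l, k].Nodup := swap_nodup h
  have hk_lj : [i, k, l, j].Nodup := swap_nodup hk_jl
  have n1 := hv.gram_mul_sub_sq_ne_zero h
  have n2 := hv.gram_mul_sub_sq_ne_zero hj_lk
  have n3 := hv.gram_mul_sub_sq_ne_zero hk_lj
  rw [two_mul_dualArea_div hd hv hl_jk, hv.fderiv_dihedral hl_jk, hv.fderiv_dihedral h,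
    hv.fderiv_dihedral hk_jl]
  have pj := (hv.gram_pos h).1
  have pk := (hv.gram_pos hk_jl).1
  have pl := (hv.gram_pos hl_jk).1
  simp only [List.nodup_cons, List.mem_cons, List.not_mem_nil, not_or, or_false] at h
  obtain ⟨⟨nij, nik, nil⟩, ⟨njk, njl⟩, nkl, -⟩ := h
  have cj := centerInner_eq hd hv nij
  have ck := centerInner_eq hd hv nik
  have cl := centerInner_eq hd hv nil
  -- These derivatives match the motion of `v l` with velocity `t • (v l - c_1234)`, as required by
  -- the rational identity.
  have gll : gramDeriv (edgeLength d) δ i l l =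
      2 * (gram (edgeLength d) i l l - centerInner v d i l) * t := by
    rw [gramDeriv, len_self, len_self, hl i nil, gram_self, cl, len_of_ne _ nil, edgeLength_edge]
    ring
  have gjl : gramDeriv (edgeLength d) δ i j l =
      (gram (edgeLength d) i j l - centerInner v d i j) * t := by
    rw [gramDeriv, hij, hl i nil, hl j njl, cj, ← hd.len_mul_sub_len_mul nij njl nil]
    ring
  have gkl : gramDeriv (edgeLength d) δ i k l =
      (gram (edgeLength d) i k l - centerInner v d i k) * t := by
    rw [gramDeriv, hik, hl i nil, hl k nkl, ck, ← hd.len_mul_sub_len_mul nik nkl nil]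
    ring
  have gjj : gramDeriv (edgeLength d) δ i j j = 0 := by
    rw [gramDeriv, hij, len_self, len_self]
    ring
  have gkk : gramDeriv (edgeLength d) δ i k k = 0 := by
    rw [gramDeriv, hik, len_self, len_self]
    ring
  have gjk : gramDeriv (edgeLength d) δ i j k = 0 := by
    rw [gramDeriv, hij, hik, hjk]
    ring
  have gcomm : ∀ a b, gramDeriv (edgeLength d) δ i a b = gramDeriv (edgeLength d) δ i b a :=
    fun a b => by
      rw [gramDeriv, gramDeriv, len_comm _ a b, len_comm δ a b]
      ring
  have key := sum_mul_angleRate_base (gram (edgeLength d) i j j) (gram (edgeLength d) i k k)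
    (gram (edgeLength d) i l l) (gram (edgeLength d) i j k) (gram (edgeLength d) i j l)
    (gram (edgeLength d) i k l) (centerInner v d i j) (centerInner v d i k) (centerInner v d i l)
    pj.ne' pk.ne' pl.ne' n1 n2 n3 t
  rw [gcomm l j, gcomm l k, gcomm k j, gll, gjl, gkl, gjj, gkk, gjk, gram_comm _ i l j,
    gram_comm _ i l k, gram_comm _ i k j]
  -- The Gram determinant at `v i` does not depend on the order of the edges, so all terms share one
  -- denominator.
  have d1 : gramDet (gram (edgeLength d) i j j) (gram (edgeLength d) i k k)
      (gram (edgeLength d) i l l) (gram (edgeLength d) i k l) (gram (edgeLength d) i j k)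
      (gram (edgeLength d) i j l) = gramDet (gram (edgeLength d) i l l)
      (gram (edgeLength d) i j j) (gram (edgeLength d) i k k) (gram (edgeLength d) i j k)
      (gram (edgeLength d) i j l) (gram (edgeLength d) i k l) := by
    unfold gramDet
    ring
  have d2 : gramDet (gram (edgeLength d) i k k) (gram (edgeLength d) i j j)
      (gram (edgeLength d) i l l) (gram (edgeLength d) i j l) (gram (edgeLength d) i j k)
      (gram (edgeLength d) i k l) = gramDet (gram (edgeLength d) i l l)
      (gram (edgeLength d) i j j) (gram (edgeLength d) i k k) (gram (edgeLength d) i j k)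
      (gram (edgeLength d) i j l) (gram (edgeLength d) i k l) := by
    unfold gramDet
    ring
  rw [d1, d2]
  -- Each inner product with the center becomes `d` times a length, and this length is the factor in
  -- the derivative of the angle.
  rw [cj, ck, cl] at key ⊢
  linear_combination key / √(gramDet (gram (edgeLength d) i l l) (gram (edgeLength d) i j j)
    (gram (edgeLength d) i k k) (gram (edgeLength d) i j k) (gram (edgeLength d) i j l)
    (gram (edgeLength d) i k l))

/-- The variation of the angles at the edges through the moving vertex `i`. -/
theorem sum_fderiv_dihedral_apex (hd : IsMetric d) (hv : IsRealization (edgeLength d) v)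
    (h : [i, j, k, l].Nodup) (hjk : len δ j k = 0) (hjl : len δ j l = 0) (hkl : len δ k l = 0)
    (hi : ∀ m, i ≠ m → len δ i m = d i m * t) :
    d i l * fderiv ℝ (dihedral i l j k) (edgeLength d) δ
      + d i j * fderiv ℝ (dihedral i j k l) (edgeLength d) δ
      + d i k * fderiv ℝ (dihedral i k j l) (edgeLength d) δ
      = (-(2 * (dualArea v d i l j k / len (edgeLength d) i l))
        - 2 * (dualArea v d i j k l / len (edgeLength d) i j)
        - 2 * (dualArea v d i k j l / len (edgeLength d) i k)) * t := by
  have hl_jk : [i, l, j, k].Nodup := by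
    simp only [List.nodup_cons, List.mem_cons, List.not_mem_nil] at h ⊢; tauto
  have hk_jl : [i, k, j, l].Nodup := by
    simp only [List.nodup_cons, List.mem_cons, List.not_mem_nil] at h ⊢; tauto
  have n1 := hv.gram_mul_sub_sq_ne_zero h
  have n2 := hv.gram_mul_sub_sq_ne_zero (swap_nodup h)
  have n3 := hv.gram_mul_sub_sq_ne_zero (swap_nodup hk_jl)
  rw [two_mul_dualArea_div hd hv hl_jk, two_mul_dualArea_div hd hv h,
    two_mul_dualArea_div hd hv hk_jl, hv.fderiv_dihedral hl_jk, hv.fderiv_dihedral h,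
    hv.fderiv_dihedral hk_jl]
  have pj := (hv.gram_pos h).1
  have pk := (hv.gram_pos hk_jl).1
  have pl := (hv.gram_pos hl_jk).1
  simp only [List.nodup_cons, List.mem_cons, List.not_mem_nil, not_or, or_false] at h
  obtain ⟨⟨nij, nik, nil⟩, ⟨njk, njl⟩, nkl, -⟩ := h
  have cj := centerInner_eq hd hv nij
  have ck := centerInner_eq hd hv nik
  have cl := centerInner_eq hd hv nil
  -- Seen from the moving vertex, the other three all have relative velocity `t • (c_1234 - v i)`.
  have gself : ∀ m, i ≠ m → gramDeriv (edgeLength d) δ i m m = 2 * centerInner v d i m * t :=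
    fun m hm => by
      rw [gramDeriv, len_self, len_self, hi m hm, centerInner_eq hd hv hm]
      ring
  have gne : ∀ m n, i ≠ m → i ≠ n → len δ m n = 0 → gramDeriv (edgeLength d) δ i m n =
      (centerInner v d i m + centerInner v d i n) * t := fun m n hm hn hmn => by
    rw [gramDeriv, hi m hm, hi n hn, centerInner_eq hd hv hm, centerInner_eq hd hv hn, hmn]
    ring
  have gcomm : ∀ a b, gramDeriv (edgeLength d) δ i a b = gramDeriv (edgeLength d) δ i b a :=
    fun a b => by
      rw [gramDeriv, gramDeriv, len_comm _ a b, len_comm δ a b]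
      ring
  have key := sum_mul_angleRate_apex (gram (edgeLength d) i j j) (gram (edgeLength d) i k k)
    (gram (edgeLength d) i l l) (gram (edgeLength d) i j k) (gram (edgeLength d) i j l)
    (gram (edgeLength d) i k l) (centerInner v d i j) (centerInner v d i k) (centerInner v d i l)
    pj.ne' pk.ne' pl.ne' n1 n2 n3 t
  rw [gcomm l j, gcomm l k, gcomm k j, gself j nij, gself k nik, gself l nil,
    gne j k nij nik hjk, gne j l nij nil hjl, gne k l nik nil hkl, gram_comm _ i l j,
    gram_comm _ i l k, gram_comm _ i k j]
  have d1 : gramDet (gram (edgeLength d) i j j) (gram (edgeLength d) i k k)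
      (gram (edgeLength d) i l l) (gram (edgeLength d) i k l) (gram (edgeLength d) i j k)
      (gram (edgeLength d) i j l) = gramDet (gram (edgeLength d) i l l)
      (gram (edgeLength d) i j j) (gram (edgeLength d) i k k) (gram (edgeLength d) i j k)
      (gram (edgeLength d) i j l) (gram (edgeLength d) i k l) := by
    unfold gramDet
    ring
  have d2 : gramDet (gram (edgeLength d) i k k) (gram (edgeLength d) i j j)
      (gram (edgeLength d) i l l) (gram (edgeLength d) i j l) (gram (edgeLength d) i j k)
      (gram (edgeLength d) i k l) = gramDet (gram (edgeLength d) i l l)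
      (gram (edgeLength d) i j j) (gram (edgeLength d) i k k) (gram (edgeLength d) i j k)
      (gram (edgeLength d) i j l) (gram (edgeLength d) i k l) := by
    unfold gramDet
    ring
  rw [d1, d2]
  rw [cj, ck, cl] at key ⊢
  linear_combination key / √(gramDet (gram (edgeLength d) i l l) (gram (edgeLength d) i j j)
    (gram (edgeLength d) i k k) (gram (edgeLength d) i j k) (gram (edgeLength d) i j l)
    (gram (edgeLength d) i k l))

end Variation

end

/-! ### The variation formulas. -/

theorem mainTheorem1 (d : Fin 4 → Fin 4 → ℝ) (hd : IsMetric d)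
    (v : Fin 4 → E3) (hv : IsRealization (edgeLength d) v)
    (δf : ℝ) (δℓ : Edge → ℝ)
    (h12 : δℓ (edge 0 1) = 0) (h13 : δℓ (edge 0 2) = 0) (h23 : δℓ (edge 1 2) = 0)
    (h14 : δℓ (edge 0 3) = d 3 0 * δf) (h24 : δℓ (edge 1 3) = d 3 1 * δf)
    (h34 : δℓ (edge 2 3) = d 3 2 * δf) :
    (∀ i j k l : Fin 4, [i, j, k, l].Nodup →
      DifferentiableAt ℝ (dihedral i j k l) (edgeLength d)) ∧
    ∀ δβ : Fin 4 → Fin 4 → Fin 4 → Fin 4 → ℝ,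
      (∀ i j k l, δβ i j k l = fderiv ℝ (dihedral i j k l) (edgeLength d) δℓ) →
      d 0 3 * δβ 0 3 1 2 + d 0 1 * δβ 0 1 2 3 + d 0 2 * δβ 0 2 1 3
        = 2 * (dualArea v d 0 3 1 2 / edgeLength d (edge 0 3)) * δf ∧
      d 1 3 * δβ 1 3 0 2 + d 1 2 * δβ 1 2 0 3 + d 1 0 * δβ 0 1 2 3
        = 2 * (dualArea v d 1 3 0 2 / edgeLength d (edge 1 3)) * δf ∧
      d 2 3 * δβ 2 3 0 1 + d 2 1 * δβ 1 2 0 3 + d 2 0 * δβ 0 2 1 3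
        = 2 * (dualArea v d 2 3 0 1 / edgeLength d (edge 2 3)) * δf ∧
      d 3 0 * δβ 0 3 1 2 + d 3 1 * δβ 1 3 0 2 + d 3 2 * δβ 2 3 0 1
        = (-(2 * (dualArea v d 0 3 1 2 / edgeLength d (edge 0 3)))
          - 2 * (dualArea v d 1 3 0 2 / edgeLength d (edge 1 3))
          - 2 * (dualArea v d 2 3 0 1 / edgeLength d (edge 2 3))) * δf := by
  have e01 : len δℓ 0 1 = 0 := (len_of_ne _ (by decide)).trans h12
  have e02 : len δℓ 0 2 = 0 := (len_of_ne _ (by decide)).trans h13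
  have e12 : len δℓ 1 2 = 0 := (len_of_ne _ (by decide)).trans h23
  have e3 : ∀ m, m ≠ 3 → len δℓ m 3 = d 3 m * δf := by
    intro m hm
    fin_cases m
    · exact (len_of_ne _ (by decide)).trans h14
    · exact (len_of_ne _ (by decide)).trans h24
    · exact (len_of_ne _ (by decide)).trans h34
    · exact absurd rfl hm
  have e3' : ∀ m, 3 ≠ m → len δℓ 3 m = d 3 m * δf := fun m hm => by
    rw [len_comm, e3 m hm.symm]
  refine ⟨fun i j k l h => hv.differentiableAt_dihedral h, fun δβ hδβ => ?_⟩
  have h0 := sum_fderiv_dihedral_base (i := 0) (j := 1) (k := 2) (l := 3) hd hv (by decide)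
    e01 e02 e12 e3
  have h1 := sum_fderiv_dihedral_base (i := 1) (j := 0) (k := 2) (l := 3) hd hv (by decide)
    (by rw [len_comm, e01]) e12 e02 e3
  have h2 := sum_fderiv_dihedral_base (i := 2) (j := 0) (k := 1) (l := 3) hd hv (by decide)
    (by rw [len_comm, e02]) (by rw [len_comm, e12]) e01 e3
  have h3 := sum_fderiv_dihedral_apex (i := 3) (j := 0) (k := 1) (l := 2) hd hv (by decide)
    e01 e02 e12 e3'
  -- The vertex lemmas orient every edge away from their base vertex, while the statement fixes one
  -- orientation per edge.
  rw [dihedral_swap_left 1 0] at h1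
  rw [dihedral_swap_left 2 0, dihedral_swap_left 2 1] at h2
  rw [dihedral_swap_left 3 0, dihedral_swap_left 3 1, dihedral_swap_left 3 2,
    dualArea_comm hv (show (3 : Fin 4) ≠ 0 by decide),
    dualArea_comm hv (show (3 : Fin 4) ≠ 1 by decide),
    dualArea_comm hv (show (3 : Fin 4) ≠ 2 by decide),
    len_comm _ 3 0, len_comm _ 3 1, len_comm _ 3 2] at h3
  simp only [hδβ, ← len_of_ne (edgeLength d)]
  refine ⟨?_, ?_, ?_, ?_⟩
  · linear_combination h0
  · linear_combination h1
  · linear_combination h2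
  · linear_combination h3
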